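/- Let $\alpha>-1$, $\lambda\ge 0$, $\nu\ge 0$ and $t>0$. Let $\rho_\nu(x)=2x^{\nu/2}K_\nu(2\sqrt x)$, $x>0$, where $K_\nu$ is the modified Bessel function of the second kind, and let $\{P_n\}_{n\ge0}$, $P_n(x)=P_n(x;\lambda,t)$, be a sequence of real polynomials with $\deg P_n=n$ that is orthonormal with respect to the weight $e^{-\lambda x}\rho_\nu(xt)x^\alpha$ on $(0,\infty)$: $$\int_0^\infty P_m(x)P_n(x)e^{-\lambda x}\rho_\nu(xt)x^\alpha\,dx=\delta_{n,m},\qquad n,m\in\mathbb N_0 .$$ Let $\theta=yDy$, $D=d/dy$, i.e. $(\theta f)(y)=y\,\frac{d}{dy}\bigl(yf(y)\bigr)$, and for a polynomial $p(x)=\sum_k p_kx^k$ put $p(\theta/t)=\sum_k p_kt^{-k}\theta^k$, where $\theta^k$ is the $k$-fold composition. Then the sequence $\{P_n\}$ is compositionally orthogonal in the sense of Laguerre: for every $n\ge1$ and every $m=0,1,\dots,n-1$, $$\int_0^\infty y^\nu e^{-y}\,P_n\!\left(\frac{\theta}{t}\right)\theta^m\left\{\frac{\Gamma(1+\alpha)\,y^\alpha}{(\lambda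 y+t)^{\alpha+1}}\right\}dy=0,$$ where the integral converges absolutely. Moreover, these conditions are the usual orthogonality conditions in another form: for every $n\ge1$ and every real polynomial $p$ of degree $n$, one has $\int_0^\infty p(x)e^{-\lambda x}\rho_\nu(xt)x^{\alpha+m}\,dx=0$ for all $m=0,\dots,n-1$ if and only if $\int_0^\infty y^\nu e^{-y}\,p(\theta/t)\,\theta^m\{\Gamma(1+\alpha)y^\alpha(\lambda y+t)^{-\alpha-1}\}\,dy=0$ for all $m=0,\dots,n-1$, where all integrals converge absolutely. -/

import Mathlib

open MeasureTheory Set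
open scoped Polynomial

noncomputable section

/-- The modified Bessel function of the second kind (Macdonald function) `K_ν(z)`, for real `ν`
and `z > 0`, as `∫₀^∞ exp (-z cosh u) cosh (ν u) du`. -/
def macdonaldK (ν z : ℝ) : ℝ :=
  ∫ u in Ioi (0 : ℝ), Real.exp (-(z * Real.cosh u)) * Real.cosh (ν * u)

/-- The scaled Macdonald function `ρ_ν(x) = 2 x^{ν/2} K_ν(2 √x)`, `x > 0`. -/
def macdonaldRho (ν x : ℝ) : ℝ :=
  2 * x ^ (ν / 2) * macdonaldK ν (2 * Real.sqrt x)

/-- The weight `e^{-λ x} ρ_ν(x t) x^α` on `(0, ∞)`. -/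
def orthoWeight (α ν lam t x : ℝ) : ℝ :=
  Real.exp (-(lam * x)) * macdonaldRho ν (x * t) * x ^ α

/-- `P` is a sequence of orthonormal polynomials for the weight, `P n` of degree exactly `n`. -/
structure IsOrthonormalSeq (α ν lam t : ℝ) (P : ℕ → ℝ[X]) : Prop where
  degree_eq : ∀ n, (P n).degree = (n : WithBot ℕ)
  integral_eq : ∀ m n,
    ∫ x in Ioi (0 : ℝ), (P m).eval x * (P n).eval x * orthoWeight α ν lam t x
      = if n = m then 1 else 0

/-- `p` is orthogonal to `1, x, …, x^{n-1}` with respect to the weight. -/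
def OrthogonalToLower (α ν lam t : ℝ) (n : ℕ) (p : ℝ[X]) : Prop :=
  ∀ m < n,
    IntegrableOn (fun x => p.eval x * orthoWeight α ν lam t x * x ^ m) (Ioi (0 : ℝ)) ∧
    ∫ x in Ioi (0 : ℝ), p.eval x * orthoWeight α ν lam t x * x ^ m = 0

/-- The operator `θ = y D y`, that is `(θ f)(y) = y (d/dy)(y f(y))`. -/
def thetaOp (f : ℝ → ℝ) : ℝ → ℝ :=
  fun y => y * deriv (fun z => z * f z) y

/-- The operator polynomial `p(A) = ∑ₖ pₖ Aᵏ`, where `Aᵏ` is the `k`-fold composition. -/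
def polyOp (p : ℝ[X]) (A : (ℝ → ℝ) → (ℝ → ℝ)) (f : ℝ → ℝ) : ℝ → ℝ :=
  fun y => ∑ k ∈ Finset.range (p.natDegree + 1), p.coeff k * (A^[k] f) y

/-- The function `Γ(1+α) y^α / (λ y + t)^{α+1}`, `y > 0`. -/
def laguerreKernel (α lam t : ℝ) : ℝ → ℝ :=
  fun y => Real.Gamma (1 + α) * y ^ α / (lam * y + t) ^ (α + 1)

/-- The integrand `y^ν e^{-y} p(θ/t) θ^m {Γ(1+α) y^α / (λ y + t)^{α+1}}`. -/
def compositionIntegrand (α ν lam t : ℝ) (p : ℝ[X]) (m : ℕ) : ℝ → ℝ :=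
  fun y => y ^ ν * Real.exp (-y) *
    polyOp p (fun f => (1 / t) • thetaOp f) (thetaOp^[m] (laguerreKernel α lam t)) y

/-- The composition orthogonality conditions in the sense of Laguerre for a polynomial `p`
and the exponents `m = 0, …, n-1`: the integrals converge absolutely and vanish. -/
def CompositionallyOrthogonal (α ν lam t : ℝ) (n : ℕ) (p : ℝ[X]) : Prop :=
  ∀ m < n,
    IntegrableOn (compositionIntegrand α ν lam t p m) (Ioi (0 : ℝ)) ∧
    ∫ y in Ioi (0 : ℝ), compositionIntegrand α ν lam t p m y = 0

end

/-! Write `ρ_ν(xt) = ∫ y^{ν-1} e^{-y-xt/y} dy` and exchange integrals. The `x`-integral is then a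
Gamma integral, so the weight with exponent `b` has total mass `∫ y^ν e^{-y} k_b(y) dy`, where `k_b`
is `laguerreKernel b lam t` (`integral_orthoWeight`). Multiplying the weight by `x` raises `b` by
one, and on the other side so does `θ/t`, since `θ k_b = t k_{b+1}` (`thetaOp_laguerreKernel`). By
linearity the composition integral is `t^m` times the integral of `p(x) x^m` against the weight
(`integral_compositionIntegrand`); as `t ≠ 0`, they vanish together. -/

/-! ### Integral representation of `ρ_ν` -/

theorem integrableOn_rpow_mul_exp_neg {s : ℝ} (hs : -1 < s) :
    IntegrableOn (fun y : ℝ => y ^ s * Real.exp (-y)) (Ioi 0) := by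
  simpa using integrableOn_rpow_mul_exp_neg_mul_rpow hs one_pos one_pos

/-- The bound `e^{-x/y} ≤ y/x` gains one power of `y` at the origin, which `ν = 0` requires. -/
theorem integrableOn_rpow_mul_exp_neg_add_div {ν x : ℝ} (hν : 0 ≤ ν) (hx : 0 < x) :
    IntegrableOn (fun y : ℝ => y ^ (ν - 1) * Real.exp (-(y + x / y))) (Ioi 0) := by
  refine Integrable.mono' ((integrableOn_rpow_mul_exp_neg (by linarith : -1 < ν)).const_mul (1 / x))
    (Measurable.aestronglyMeasurable (by fun_prop)) ?_
  filter_upwards [ae_restrict_mem measurableSet_Ioi] with y hy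
  have hy : 0 < y := hy
  have h : Real.exp (-(x / y)) ≤ y / x := by
    rw [Real.exp_neg, ← inv_div x y]
    exact inv_anti₀ (by positivity) (by linarith [Real.add_one_le_exp (x / y)])
  rw [Real.norm_of_nonneg (by positivity), neg_add, Real.exp_add]
  calc y ^ (ν - 1) * (Real.exp (-y) * Real.exp (-(x / y)))
      ≤ y ^ (ν - 1) * (Real.exp (-y) * (y / x)) := by gcongr
    _ = 1 / x * (y ^ (ν - 1) * y * Real.exp (-y)) := by ring
    _ = 1 / x * (y ^ ν * Real.exp (-y)) := by
      rw [← Real.rpow_add_one hy.ne', sub_add_cancel]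

theorem image_mul_exp_univ {c : ℝ} (hc : 0 < c) :
    (fun u : ℝ => c * Real.exp u) '' univ = Ioi 0 := by
  ext y
  simp only [image_univ, mem_range, mem_Ioi]
  constructor
  · rintro ⟨u, rfl⟩
    positivity
  · intro hy
    exact ⟨Real.log (y / c), by rw [Real.exp_log (by positivity)]; field_simp⟩

/-- With `y = √x e^u` the exponent `y + x/y` becomes the even function `2√x cosh u`. -/
theorem sqrt_mul_exp_substitution (ν : ℝ) {x : ℝ} (hx : 0 < x) (u : ℝ) :
    |√x * Real.exp u| • ((√x * Real.exp u) ^ (ν - 1) *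
        Real.exp (-(√x * Real.exp u + x / (√x * Real.exp u))))
      = x ^ (ν / 2) * (Real.exp (-(2 * √x * Real.cosh u)) * Real.exp (ν * u)) := by
  have hs : 0 < √x := Real.sqrt_pos.2 hx
  have h1 : x / (√x * Real.exp u) = √x * Real.exp (-u) := by
    rw [Real.exp_neg]
    field_simp
    rw [Real.sq_sqrt hx.le]
  have h2 : (√x * Real.exp u) ^ (ν - 1) * (√x * Real.exp u) = x ^ (ν / 2) * Real.exp (ν * u) := by
    rw [← Real.rpow_add_one (by positivity), sub_add_cancel, Real.mul_rpow hs.le (Real.exp_pos u).le,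
      ← Real.exp_mul, Real.sqrt_eq_rpow, ← Real.rpow_mul hx.le, mul_comm u ν]
    congr 2
    ring
  rw [abs_of_pos (by positivity), smul_eq_mul, h1, Real.cosh_eq]
  calc _ = ((√x * Real.exp u) ^ (ν - 1) * (√x * Real.exp u)) *
        Real.exp (-(√x * Real.exp u + √x * Real.exp (-u))) := by ring
    _ = _ := by
      rw [h2, show 2 * √x * ((Real.exp u + Real.exp (-u)) / 2)
        = √x * Real.exp u + √x * Real.exp (-u) by ring]
      ring

/-- The integral representation `ρ_ν(x) = ∫₀^∞ y^{ν-1} e^{-y-x/y} dy`. -/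
theorem macdonaldRho_eq_integral {ν x : ℝ} (hν : 0 ≤ ν) (hx : 0 < x) :
    macdonaldRho ν x = ∫ y in Ioi (0 : ℝ), y ^ (ν - 1) * Real.exp (-(y + x / y)) := by
  have hs : 0 < √x := Real.sqrt_pos.2 hx
  have hderiv : ∀ u ∈ (univ : Set ℝ), HasDerivWithinAt (fun u : ℝ => √x * Real.exp u)
      (√x * Real.exp u) univ u := fun u _ =>
    ((Real.hasDerivAt_exp u).const_mul _).hasDerivWithinAt
  have hinj : InjOn (fun u : ℝ => √x * Real.exp u) univ := fun u _ v _ h =>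
    Real.exp_injective (mul_left_cancel₀ hs.ne' h)
  set G : ℝ → ℝ := fun u => x ^ (ν / 2) * (Real.exp (-(2 * √x * Real.cosh u)) * Real.exp (ν * u))
    with hG
  have hint : Integrable G := by
    have h := integrableOn_rpow_mul_exp_neg_add_div hν hx
    rw [← image_mul_exp_univ hs,
      integrableOn_image_iff_integrableOn_abs_deriv_smul MeasurableSet.univ hderiv hinj,
      integrableOn_univ] at h
    simpa only [sqrt_mul_exp_substitution ν hx] using h
  have heq : ∫ y in Ioi (0 : ℝ), y ^ (ν - 1) * Real.exp (-(y + x / y)) = ∫ u, G u := by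
    rw [← image_mul_exp_univ hs,
      integral_image_eq_integral_abs_deriv_smul MeasurableSet.univ hderiv hinj, Measure.restrict_univ]
    simp only [sqrt_mul_exp_substitution ν hx, hG]
  have hneg := integral_comp_neg_Ioi 0 G
  rw [neg_zero] at hneg
  -- Folding the negative half-line onto the positive one turns `e^{νu}` into `2 cosh(νu)`.
  rw [heq, ← intervalIntegral.integral_Iic_add_Ioi hint.integrableOn (b := 0) hint.integrableOn,
    ← hneg, ← integral_add hint.comp_neg.integrableOn hint.integrableOn, macdonaldRho, macdonaldK,
    ← integral_const_mul]
  refine integral_congr_ae (.of_forall fun u => ?_)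
  simp only [hG, Real.cosh_neg, Real.cosh_eq (ν * u), mul_neg]
  ring

/-! ### Moments of the weight by Fubini -/

theorem integral_rpow_mul_exp_neg_mul_add_div {b lam t y : ℝ} (hb : -1 < b) (hlam : 0 ≤ lam)
    (ht : 0 < t) (hy : 0 < y) :
    ∫ x in Ioi (0 : ℝ), x ^ b * Real.exp (-((lam + t / y) * x)) = y * laguerreKernel b lam t y := by
  have h := Real.integral_rpow_mul_exp_neg_mul_Ioi (a := b + 1) (r := lam + t / y) (by linarith)
    (by positivity)
  rw [add_sub_cancel_right] at h
  rw [h, laguerreKernel, show 1 / (lam + t / y) = y / (lam * y + t) by field_simp,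
    Real.div_rpow hy.le (by positivity), Real.rpow_add_one hy.ne', add_comm 1 b]
  ring

theorem laguerreKernel_nonneg {b lam t y : ℝ} (hb : -1 < b) (hlam : 0 ≤ lam)
    (ht : 0 < t) (hy : 0 < y) : 0 ≤ laguerreKernel b lam t y := by
  have := Real.Gamma_pos_of_pos (by linarith : 0 < 1 + b)
  unfold laguerreKernel
  positivity

theorem integrableOn_rpow_mul_exp_neg_mul_laguerreKernel {b ν lam t : ℝ} (hb : -1 < b)
    (hν : 0 ≤ ν) (hlam : 0 ≤ lam) (ht : 0 < t) :
    IntegrableOn (fun y => y ^ ν * Real.exp (-y) * laguerreKernel b lam t y) (Ioi 0) := by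
  have hΓ := Real.Gamma_pos_of_pos (by linarith : 0 < 1 + b)
  refine Integrable.mono' ((integrableOn_rpow_mul_exp_neg (by linarith : -1 < ν + b)).const_mul
    (Real.Gamma (1 + b) / t ^ (b + 1))) (Measurable.aestronglyMeasurable ?_) ?_
  · unfold laguerreKernel
    fun_prop
  filter_upwards [ae_restrict_mem measurableSet_Ioi] with y hy
  have hy : 0 < y := hy
  have hk := laguerreKernel_nonneg hb hlam ht hy
  have hle : t ^ (b + 1) ≤ (lam * y + t) ^ (b + 1) :=
    Real.rpow_le_rpow ht.le (le_add_of_nonneg_left (by positivity)) (by linarith)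
  rw [Real.norm_of_nonneg (by positivity), laguerreKernel]
  calc y ^ ν * Real.exp (-y) * (Real.Gamma (1 + b) * y ^ b / (lam * y + t) ^ (b + 1))
      ≤ y ^ ν * Real.exp (-y) * (Real.Gamma (1 + b) * y ^ b / t ^ (b + 1)) := by gcongr
    _ = _ := by
      rw [Real.rpow_add hy]
      ring

/-- Tonelli: the integrand is nonnegative on the quadrant, and integrating in `x` first gives a
closed form. -/
theorem integrable_weight_kernel {b ν lam t : ℝ} (hb : -1 < b)
    (hν : 0 ≤ ν) (hlam : 0 ≤ lam) (ht : 0 < t) :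
    Integrable (Function.uncurry fun x y : ℝ => y ^ (ν - 1) * Real.exp (-y) *
        (x ^ b * Real.exp (-((lam + t / y) * x))))
      ((volume.restrict (Ioi 0)).prod (volume.restrict (Ioi 0))) := by
  rw [integrable_prod_iff' (Measurable.aestronglyMeasurable (by unfold Function.uncurry; fun_prop))]
  constructor
  · filter_upwards [ae_restrict_mem measurableSet_Ioi] with y hy
    have hy : 0 < y := hy
    have h := integrableOn_rpow_mul_exp_neg_mul_rpow (b := lam + t / y) hb one_pos (by positivity)
    simp only [Real.rpow_one, neg_mul] at h
    exact Integrable.const_mul h (y ^ (ν - 1) * Real.exp (-y))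
  · refine (integrableOn_rpow_mul_exp_neg_mul_laguerreKernel hb hν hlam ht).congr_fun ?_
      measurableSet_Ioi
    intro y hy
    have hy : 0 < y := hy
    have hnorm : EqOn (fun x : ℝ => ‖y ^ (ν - 1) * Real.exp (-y) *
        (x ^ b * Real.exp (-((lam + t / y) * x)))‖) (fun x => y ^ (ν - 1) * Real.exp (-y) *
        (x ^ b * Real.exp (-((lam + t / y) * x)))) (Ioi 0) := fun x hx => by
      have hx : 0 < x := hx
      exact Real.norm_of_nonneg (by positivity)
    simp only [Function.uncurry]
    rw [setIntegral_congr_fun measurableSet_Ioi hnorm, integral_const_mul,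
      integral_rpow_mul_exp_neg_mul_add_div hb hlam ht hy,
      show ν = ν - 1 + 1 by ring, Real.rpow_add_one hy.ne', add_sub_cancel_right]
    ring

theorem orthoWeight_eq_integral {b ν lam t x : ℝ} (hν : 0 ≤ ν) (ht : 0 < t) (hx : 0 < x) :
    orthoWeight b ν lam t x = ∫ y in Ioi (0 : ℝ), y ^ (ν - 1) * Real.exp (-y) *
        (x ^ b * Real.exp (-((lam + t / y) * x))) := by
  rw [orthoWeight, macdonaldRho_eq_integral hν (by positivity), mul_right_comm, ← integral_const_mul]
  refine integral_congr_ae (.of_forall fun y => ?_)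
  simp only
  rw [show -((lam + t / y) * x) = -(lam * x) + -(x * t / y) by ring, neg_add, Real.exp_add,
    Real.exp_add]
  ring

theorem integrableOn_orthoWeight {b ν lam t : ℝ} (hb : -1 < b)
    (hν : 0 ≤ ν) (hlam : 0 ≤ lam) (ht : 0 < t) :
    IntegrableOn (orthoWeight b ν lam t) (Ioi 0) :=
  (IntegrableOn.congr_fun (integrable_weight_kernel hb hν hlam ht).integral_prod_left
    (fun _ hx => (orthoWeight_eq_integral hν ht hx).symm) measurableSet_Ioi)

theorem integral_orthoWeight {b ν lam t : ℝ} (hb : -1 < b)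
    (hν : 0 ≤ ν) (hlam : 0 ≤ lam) (ht : 0 < t) :
    ∫ x in Ioi (0 : ℝ), orthoWeight b ν lam t x
      = ∫ y in Ioi (0 : ℝ), y ^ ν * Real.exp (-y) * laguerreKernel b lam t y := by
  rw [setIntegral_congr_fun measurableSet_Ioi fun x hx => orthoWeight_eq_integral hν ht hx,
    integral_integral_swap (integrable_weight_kernel hb hν hlam ht)]
  refine setIntegral_congr_fun measurableSet_Ioi fun y hy => ?_
  have hy : 0 < y := hy
  rw [integral_const_mul, integral_rpow_mul_exp_neg_mul_add_div hb hlam ht hy]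
  nth_rw 2 [show ν = ν - 1 + 1 by ring]
  rw [Real.rpow_add_one hy.ne']
  ring

theorem orthoWeight_mul_pow (α ν lam t : ℝ) (k : ℕ) {x : ℝ} (hx : 0 < x) :
    orthoWeight α ν lam t x * x ^ k = orthoWeight (α + k) ν lam t x := by
  rw [orthoWeight, orthoWeight, Real.rpow_add_natCast hx.ne', mul_assoc]

/-! ### Action of `θ` on the kernels -/

theorem thetaOp_congr {f g : ℝ → ℝ} (h : EqOn f g (Ioi 0)) :
    EqOn (thetaOp f) (thetaOp g) (Ioi 0) := by
  intro y hy
  have hev : (fun z => z * f z) =ᶠ[nhds y] fun z => z * g z := by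
    filter_upwards [Ioi_mem_nhds (mem_Ioi.1 hy)] with z hz
    rw [h hz]
  rw [thetaOp, thetaOp, hev.deriv_eq]

theorem thetaOp_const_smul (c : ℝ) (f : ℝ → ℝ) : thetaOp (c • f) = c • thetaOp f := by
  funext y
  have h : (fun z => z * (c • f) z) = fun z => c * (z * f z) := by
    funext z
    simp only [Pi.smul_apply, smul_eq_mul]
    ring
  rw [thetaOp, h, deriv_const_mul_field', Pi.smul_apply, smul_eq_mul, thetaOp]
  ring

/-- Here `y k_b(y) = Γ(1+b) (y/(λy+t))^{b+1}`, the Möbius map has derivative `t/(λy+t)^2`, and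
`(b+1) Γ(b+1) = Γ(b+2)`. -/
theorem thetaOp_laguerreKernel {b lam t : ℝ} (hb : -1 < b) (hlam : 0 ≤ lam) (ht : 0 < t) :
    EqOn (thetaOp (laguerreKernel b lam t)) (t • laguerreKernel (b + 1) lam t) (Ioi 0) := by
  intro y hy
  have hy : 0 < y := hy
  have hpos : 0 < lam * y + t := by positivity
  have hev : (fun z => z * laguerreKernel b lam t z) =ᶠ[nhds y]
      fun z => Real.Gamma (1 + b) * (z / (lam * z + t)) ^ (b + 1) := by
    filter_upwards [Ioi_mem_nhds hy] with z hz
    have hz : 0 < z := hz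
    rw [laguerreKernel, Real.div_rpow hz.le (by positivity), Real.rpow_add_one hz.ne']
    ring
  have hq : HasDerivAt (fun z => z / (lam * z + t)) (t / (lam * y + t) ^ 2) y := by
    have h := (hasDerivAt_id' y).div (((hasDerivAt_id' y).const_mul lam).add_const t) hpos.ne'
    exact h.congr_deriv (by ring)
  have hd := ((hq.rpow_const (p := b + 1) (Or.inl (by positivity))).const_mul (Real.Gamma (1 + b)))
  rw [thetaOp, hev.deriv_eq, hd.deriv, Pi.smul_apply, smul_eq_mul, laguerreKernel,
    show 1 + (b + 1) = (1 + b) + 1 by ring, Real.Gamma_add_one (by linarith), add_sub_cancel_right,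
    Real.div_rpow hy.le hpos.le, Real.rpow_add_one hy.ne', Real.rpow_add_one hpos.ne',
    Real.rpow_add_one hpos.ne']
  have := (Real.rpow_pos_of_pos hpos b).ne'
  field_simp
  ring

/-- Serves `θ^m` with `c = 1`, then `(θ/t)^k` with `c = 1/t` and `d = t^m`, starting from the first
output, known only on `y > 0`. -/
theorem iterate_smul_thetaOp_laguerreKernel {b lam t : ℝ} (hb : -1 < b) (hlam : 0 ≤ lam)
    (ht : 0 < t) (c d : ℝ) {f : ℝ → ℝ} (hf : EqOn f (d • laguerreKernel b lam t) (Ioi 0)) (k : ℕ) :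
    EqOn ((fun f => c • thetaOp f)^[k] f) (((c * t) ^ k * d) • laguerreKernel (b + k) lam t)
      (Ioi 0) := by
  induction k with
  | zero => simpa using hf
  | succ k ih =>
    rw [Function.iterate_succ_apply']
    intro y hy
    have h := thetaOp_laguerreKernel (b := b + k) (by linarith [k.cast_nonneg (α := ℝ)]) hlam ht hy
    simp only [Pi.smul_apply]
    rw [thetaOp_congr ih hy, thetaOp_const_smul, Pi.smul_apply, h]
    simp only [Pi.smul_apply, smul_eq_mul, Nat.cast_add, Nat.cast_one, ← add_assoc]
    ring

/-! ### Termwise comparison of the two integrals -/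

theorem compositionIntegrand_eq_sum {α ν lam t : ℝ} (hα : -1 < α) (hlam : 0 ≤ lam)
    (ht : 0 < t) (p : ℝ[X]) (m : ℕ) :
    EqOn (compositionIntegrand α ν lam t p m) (fun y => ∑ k ∈ Finset.range (p.natDegree + 1),
      t ^ m * p.coeff k * (y ^ ν * Real.exp (-y) * laguerreKernel (α + (m + k : ℕ)) lam t y))
      (Ioi 0) := by
  intro y hy
  have hm := iterate_smul_thetaOp_laguerreKernel hα hlam ht 1 1
    (f := laguerreKernel α lam t) (by intro y _; simp) m
  simp only [one_smul, one_mul, mul_one] at hm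
  simp only [compositionIntegrand, polyOp, Finset.mul_sum]
  refine Finset.sum_congr rfl fun k _ => ?_
  have hk := iterate_smul_thetaOp_laguerreKernel (b := α + m)
    (by linarith [m.cast_nonneg (α := ℝ)]) hlam ht (1 / t) (t ^ m) hm k hy
  rw [hk, one_div_mul_cancel ht.ne', one_pow, one_mul, Pi.smul_apply, smul_eq_mul, Nat.cast_add,
    ← add_assoc]
  ring

theorem eval_mul_orthoWeight_mul_pow_eq_sum (α ν lam t : ℝ) (p : ℝ[X]) (m : ℕ) :
    EqOn (fun x => p.eval x * orthoWeight α ν lam t x * x ^ m)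
      (fun x => ∑ k ∈ Finset.range (p.natDegree + 1),
        p.coeff k * orthoWeight (α + (m + k : ℕ)) ν lam t x) (Ioi 0) := by
  intro x hx
  simp only [Polynomial.eval_eq_sum_range, Finset.sum_mul]
  refine Finset.sum_congr rfl fun k _ => ?_
  rw [← orthoWeight_mul_pow α ν lam t (m + k) hx, pow_add]
  ring

section

variable {α ν lam t : ℝ} (hα : -1 < α) (hν : 0 ≤ ν) (hlam : 0 ≤ lam) (ht : 0 < t)
include hα hν hlam ht

theorem integrableOn_eval_mul_orthoWeight_mul_pow (p : ℝ[X]) (m : ℕ) :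
    IntegrableOn (fun x => p.eval x * orthoWeight α ν lam t x * x ^ m) (Ioi 0) := by
  rw [integrableOn_congr_fun (eval_mul_orthoWeight_mul_pow_eq_sum α ν lam t p m) measurableSet_Ioi]
  exact integrable_finsetSum _ fun k _ => (integrableOn_orthoWeight
    (by linarith [(m + k).cast_nonneg (α := ℝ)]) hν hlam ht).const_mul _

theorem integrableOn_compositionIntegrand (p : ℝ[X]) (m : ℕ) :
    IntegrableOn (compositionIntegrand α ν lam t p m) (Ioi 0) := by
  rw [integrableOn_congr_fun (compositionIntegrand_eq_sum hα hlam ht p m) measurableSet_Ioi]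
  exact integrable_finsetSum _ fun k _ => (integrableOn_rpow_mul_exp_neg_mul_laguerreKernel
    (by linarith [(m + k).cast_nonneg (α := ℝ)]) hν hlam ht).const_mul _

theorem integral_compositionIntegrand (p : ℝ[X]) (m : ℕ) :
    ∫ y in Ioi (0 : ℝ), compositionIntegrand α ν lam t p m y
      = t ^ m * ∫ x in Ioi (0 : ℝ), p.eval x * orthoWeight α ν lam t x * x ^ m := by
  have hb (k : ℕ) : -1 < α + (m + k : ℕ) := by linarith [(m + k).cast_nonneg (α := ℝ)]
  rw [setIntegral_congr_fun measurableSet_Ioi (compositionIntegrand_eq_sum hα hlam ht p m),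
    setIntegral_congr_fun measurableSet_Ioi (eval_mul_orthoWeight_mul_pow_eq_sum α ν lam t p m),
    integral_finsetSum _ fun k _ =>
      (integrableOn_rpow_mul_exp_neg_mul_laguerreKernel (hb k) hν hlam ht).const_mul _,
    integral_finsetSum _ fun k _ => (integrableOn_orthoWeight (hb k) hν hlam ht).const_mul _,
    Finset.mul_sum]
  refine Finset.sum_congr rfl fun k _ => ?_
  rw [integral_const_mul, integral_const_mul, integral_orthoWeight (hb k) hν hlam ht, mul_assoc]

theorem orthogonalToLower_iff_compositionallyOrthogonal (n : ℕ) (p : ℝ[X]) :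
    OrthogonalToLower α ν lam t n p ↔ CompositionallyOrthogonal α ν lam t n p := by
  refine forall₂_congr fun m _ => ?_
  simp only [integrableOn_eval_mul_orthoWeight_mul_pow hα hν hlam ht p m,
    integrableOn_compositionIntegrand hα hν hlam ht p m,
    integral_compositionIntegrand hα hν hlam ht p m, mul_eq_zero, pow_ne_zero m ht.ne',
    true_and, false_or]

theorem integrableOn_eval_mul_eval_mul_orthoWeight (p q : ℝ[X]) :
    IntegrableOn (fun x => p.eval x * q.eval x * orthoWeight α ν lam t x) (Ioi 0) := by
  simpa using integrableOn_eval_mul_orthoWeight_mul_pow hα hν hlam ht (p * q) 0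

/-- Since `deg P_i = i`, the polynomials `P_0, …, P_{n-1}` span all those of degree below `n`,
including `x^m`. -/
theorem IsOrthonormalSeq.orthogonalToLower {P : ℕ → ℝ[X]} (hP : IsOrthonormalSeq α ν lam t P)
    (n : ℕ) : OrthogonalToLower α ν lam t n (P n) := by
  let S : Polynomial.Sequence ℝ := ⟨P, hP.degree_eq⟩
  intro m hm
  refine ⟨integrableOn_eval_mul_orthoWeight_mul_pow hα hν hlam ht _ m, ?_⟩
  have hspan : Submodule.span ℝ (S '' Iio n) = Polynomial.degreeLT ℝ n := S.span_degreeLT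
    fun i _ => (Polynomial.leadingCoeff_ne_zero.2 (S.ne_zero i)).isUnit
  have hmem : (Polynomial.X ^ m : ℝ[X]) ∈ Submodule.span ℝ (S '' Iio n) := by
    rw [hspan, Polynomial.mem_degreeLT, Polynomial.degree_X_pow]
    exact_mod_cast hm
  have hint := integrableOn_eval_mul_eval_mul_orthoWeight hα hν hlam ht (P n)
  have key : ∀ q ∈ Submodule.span ℝ (S '' Iio n),
      ∫ x in Ioi (0 : ℝ), (P n).eval x * q.eval x * orthoWeight α ν lam t x = 0 := by
    intro q hq
    induction hq using Submodule.span_induction with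
    | mem q hq =>
      obtain ⟨i, hi, rfl⟩ := hq
      exact (hP.integral_eq n i).trans (if_neg (ne_of_lt hi))
    | zero => simp
    | add q r _ _ hq hr =>
      simp only [Polynomial.eval_add, mul_add, add_mul]
      rw [integral_add (hint q) (hint r), hq, hr, add_zero]
    | smul c q _ hq =>
      simp only [Polynomial.eval_smul, smul_eq_mul, mul_left_comm _ c, mul_assoc c]
      rw [integral_const_mul, hq, mul_zero]
  simpa [mul_right_comm] using key _ hmem

end

theorem theorem5 (α ν lam t : ℝ) (hα : -1 < α) (hν : 0 ≤ ν) (hlam : 0 ≤ lam) (ht : 0 < t)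
    (P : ℕ → ℝ[X]) (hP : IsOrthonormalSeq α ν lam t P) :
    (∀ n : ℕ, 1 ≤ n → CompositionallyOrthogonal α ν lam t n (P n)) ∧
    (∀ n : ℕ, 1 ≤ n → ∀ p : ℝ[X], p.degree = (n : WithBot ℕ) →
      (OrthogonalToLower α ν lam t n p ↔ CompositionallyOrthogonal α ν lam t n p)) :=
  ⟨fun n _ => (orthogonalToLower_iff_compositionallyOrthogonal hα hν hlam ht n (P n)).1
    (hP.orthogonalToLower hα hν hlam ht n),
  fun n _ p _ => orthogonalToLower_iff_compositionallyOrthogonal hα hν hlam ht n p⟩
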